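/- Let $\mathbb{F}$ be a field and $c$ a natural number. A *Lazard Lie algebra* (LLA) is a Lie algebra $L$ over $\mathbb{F}$ with a distinguished sequence of subalgebras $L = P_1(L) \supseteq P_2(L) \supseteq \dots \supseteq P_{c+1}(L) = 0$ such that $[P_i(L), P_j(L)] \subseteq P_{i+j}(L)$ for all $i, j \ge 1$, where $P_k(L) = 0$ for $k > c$; so $L$ is nilpotent of class at most $c$. A *homomorphism* of LLAs is a Lie algebra homomorphism $f : L \to M$ with $f(P_i(L)) \subseteq P_i(M)$ for all $i$; it is an *embedding* if it is injective and, for all $x \in L$ and all $i$, $x \in P_i(L)$ if and only if $f(x) \in P_i(M)$. Theorem. Let $A, B, C$ be LLAs and let $f_0 : C \to A$ and $g_0 : C \to B$ be embeddings. Then there is a free amalgam $A \otimes_C B$ of $A$ and $B$ over $C$, that is, an LLA $S$ with embeddings $f_1 : A \to S$ and $g_1 : B \to S$ such that $f_1 \circ f_0 = g_1 \circ g_0$ and: 1. $S$ is generated as a Lie algebra by $f_1(A) \cup g_1(B)$; 2. (strongness) $f_1(A) \cap g_1(B) = f_1(f_0(C))$; 3. (freeness) for every LLA $D$ and all homomorphisms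 $f : A \to D$ and $g : B \to D$ of LLAs with $f \circ f_0 = g \circ g_0$, there is a unique homomorphism of LLAs $h : S \to D$ with $h \circ f_1 = f$ and $h \circ g_1 = g$. -/

import Mathlib

/-- A Lazard series of length `c` on a Lie algebra `L` over `F`: subalgebras
`L = P 1 ⊇ P 2 ⊇ ... ⊇ P (c + 1) = 0` with `[P i, P j] ⊆ P (i + j)`, where `P k = 0` for all `k > c`.
The index `0` carries no information: `P 0 = P 1 = L` follows from the first two conditions.
A Lie algebra together with such a series is a Lazard Lie algebra (it is nilpotent of class
at most `c`). -/
structure LazardSeries (F L : Type*) [Field F] [LieRing L] [LieAlgebra F L] (c : ℕ) where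
  /-- The terms of the series. -/
  P : ℕ → LieSubalgebra F L
  antitone : Antitone P
  one_eq_top : P 1 = ⊤
  eq_bot_of_lt : ∀ k, c < k → P k = ⊥
  lie_mem : ∀ i j (x y : L), x ∈ P i → y ∈ P j → ⁅x, y⁆ ∈ P (i + j)

section

variable {F L M : Type*} [Field F] [LieRing L] [LieAlgebra F L] [LieRing M] [LieAlgebra F M] {c : ℕ}

/-- A homomorphism of Lazard Lie algebras: a Lie algebra homomorphism that preserves the
predicates for the series. -/
def IsLazardHom (PL : LazardSeries F L c) (PM : LazardSeries F M c) (f : L →ₗ⁅F⁆ M) : Prop :=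
  ∀ i x, x ∈ PL.P i → f x ∈ PM.P i

/-- An embedding of Lazard Lie algebras: an injective Lie algebra homomorphism that preserves and
reflects the predicates for the series. -/
def IsLazardEmbedding (PL : LazardSeries F L c) (PM : LazardSeries F M c) (f : L →ₗ⁅F⁆ M) : Prop :=
  Function.Injective f ∧ ∀ i x, x ∈ PL.P i ↔ f x ∈ PM.P i

end

/-- `S`, with the maps `f₁ : A → S` and `g₁ : B → S`, is a free amalgam of the Lazard Lie
algebras `A` and `B` over `C` along `f₀ : C → A` and `g₀ : C → B`. The universal
property is tested on Lazard Lie algebras in the universe `w`. -/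
structure IsFreeAmalgam.{w, u, v₀, v₁, v₂, v₃} {F : Type u} [Field F] {c : ℕ}
    {C : Type v₀} [LieRing C] [LieAlgebra F C] {A : Type v₁} [LieRing A] [LieAlgebra F A]
    {B : Type v₂} [LieRing B] [LieAlgebra F B] {S : Type v₃} [LieRing S] [LieAlgebra F S]
    (PA : LazardSeries F A c) (PB : LazardSeries F B c) (PS : LazardSeries F S c)
    (f₀ : C →ₗ⁅F⁆ A) (g₀ : C →ₗ⁅F⁆ B) (f₁ : A →ₗ⁅F⁆ S) (g₁ : B →ₗ⁅F⁆ S) : Prop where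
  /-- `S` is an amalgam of `A` and `B` over `C`. -/
  embedding_left : IsLazardEmbedding PA PS f₁
  embedding_right : IsLazardEmbedding PB PS g₁
  comp_eq : f₁.comp f₀ = g₁.comp g₀
  /-- `S` is generated by the images of `A` and `B`. -/
  generates : LieSubalgebra.lieSpan F S (Set.range f₁ ∪ Set.range g₁) = ⊤
  /-- Strongness: the images of `A` and `B` meet in the image of `C`. -/
  strong : Set.range f₁ ∩ Set.range g₁ = Set.range (f₁.comp f₀)
  /-- Freeness: homomorphisms on `A` and `B` that agree on `C` extend uniquely to `S`. -/
  free : ∀ (D : Type w) [LieRing D] [LieAlgebra F D] (PD : LazardSeries F D c)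
    (f : A →ₗ⁅F⁆ D) (g : B →ₗ⁅F⁆ D), IsLazardHom PA PD f → IsLazardHom PB PD g →
    f.comp f₀ = g.comp g₀ →
    ∃! h : S →ₗ⁅F⁆ D, IsLazardHom PS PD h ∧ h.comp f₁ = f ∧ h.comp g₁ = g

universe w u v₀ v₁ v₂

-- The amalgam is forced by its universal property: give the free Lie algebra on `A ⊕ B` the least
-- filtration that contains the series of `A` and `B` and puts the defining relations in every term,
-- then divide by the term `c + 1`. Generation and freeness are formal. The content is that nothing
-- collapses: an element of `A` or `B` must gain no weight, and `a - b` may have weight `c + 1` only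
-- if `a` comes from `C`.
--
-- It suffices to exhibit one filtered Lie algebra that receives `A` and `B` compatibly and detects
-- this, since `Weight.lift_mem` carries weights into it. Extend an adapted basis of `C` to adapted
-- bases of `A` and of `B`, and take polynomials in the union of all basis elements. As in the
-- Poincaré–Birkhoff–Witt theorem, `A` acts on them through ordered monomials, with the variables
-- proper to `B` inert (`action_lie`); `B` acts symmetrically. The basis of `C` comes first in both
-- orders, so rewriting for an element of `C` never leaves `C`, and the two actions agree there
-- (`action_eq_action`). The bases are adapted, so elements of `P n` raise weights by `n`
-- (`action_mem_weightGE`). Applied to the monomial `1`, an element returns its own linear form;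
-- hence weights are reflected, and comparing linear forms gives strongness
-- (`exists_strong_representation`).

attribute [local instance] LieRing.ofAssociativeRing

/-! ### The Poincaré–Birkhoff–Witt action on polynomials -/

namespace PBW

section

variable {R L J I : Type*} [CommRing R] [LieRing L] [LieAlgebra R L]

section Induction

variable {M : Type*} [AddCommGroup M] [Module R M]

lemma map_mem_of_mem_supported {X : Type*} (T : (X →₀ R) →ₗ[R] M) (W : Submodule R M) {S : Set X}
    (h : ∀ s ∈ S, T (Finsupp.single s 1) ∈ W) {v : X →₀ R}
    (hv : v ∈ Finsupp.supported R R S) : T v ∈ W := by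
  rw [Finsupp.supported_eq_span_single] at hv
  have : Submodule.span R ((fun i => Finsupp.single i (1 : R)) '' S) ≤ W.comap T := by
    rw [Submodule.span_le]
    rintro _ ⟨s, hs, rfl⟩
    exact h s hs
  exact this hv

lemma map_mem_of_basis (b : Module.Basis J R L) (T : L →ₗ[R] M) (W : Submodule R M)
    (h : ∀ j, T (b j) ∈ W) (x : L) : T x ∈ W := by
  have : Submodule.span R (Set.range b) ≤ W.comap T := by
    rw [Submodule.span_le]
    rintro _ ⟨j, rfl⟩
    exact h j
  exact this (b.mem_span x)

end Induction

/-- Multiplication of polynomials, spanned by the monomials `Multiset I`, by linear forms. -/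
noncomputable def mulVar (b : Module.Basis J R L) (e : J → I) :
    L →ₗ[R] Module.End R (Multiset I →₀ R) :=
  b.constr R fun j => Finsupp.lmapDomain R R (e j ::ₘ ·)

lemma mulVar_basis (b : Module.Basis J R L) (e : J → I) (j : J) (s : Multiset I) :
    mulVar b e (b j) (Finsupp.single s 1) = Finsupp.single (e j ::ₘ s) 1 := by
  simp [mulVar]

/-- The polynomials of degree at most `n`. -/
abbrev degLE (R I : Type*) [CommRing R] (n : ℕ) : Submodule R (Multiset I →₀ R) :=
  Finsupp.supported R R {s | s.card ≤ n}

lemma degLE_mono {m n : ℕ} (h : m ≤ n) : degLE R I m ≤ degLE R I n :=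
  Finsupp.supported_mono fun _ hs => le_trans hs h

lemma single_mem_degLE {s : Multiset I} {n : ℕ} (h : s.card ≤ n) :
    Finsupp.single s (1 : R) ∈ degLE R I n :=
  Finsupp.single_mem_supported R 1 h

lemma mulVar_mem_degLE (b : Module.Basis J R L) (e : J → I) (x : L) {n : ℕ}
    {v : Multiset I →₀ R} (hv : v ∈ degLE R I n) : mulVar b e x v ∈ degLE R I (n + 1) := by
  refine map_mem_of_basis b ((mulVar b e).flip v) _ (fun j => ?_) x
  refine map_mem_of_mem_supported (mulVar b e (b j)) _ (fun s hs => ?_) hv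
  rw [mulVar_basis]
  exact single_mem_degLE (by simpa using hs)

/-- The elements of weight at least `n`. -/
abbrev basisGE (b : Module.Basis J R L) (e : J → I) (ω : I → ℕ) (n : ℕ) : Submodule R L := Submodule.span R (b '' {j | n ≤ ω (e j)})

lemma map_mem_of_mem_basisGE (b : Module.Basis J R L) (e : J → I) (ω : I → ℕ) {M : Type*} [AddCommGroup M] [Module R M] (T : L →ₗ[R] M)
    (W : Submodule R M) {n : ℕ} (h : ∀ j, n ≤ ω (e j) → T (b j) ∈ W) {x : L}
    (hx : x ∈ basisGE b e ω n) : T x ∈ W := by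
  have : basisGE b e ω n ≤ W.comap T := by
    rw [Submodule.span_le]
    rintro _ ⟨j, hj, rfl⟩
    exact h j hj
  exact this hx

/-- The polynomials all of whose monomials have weight at least `n`. -/
abbrev weightGE (R : Type*) {I : Type*} [CommRing R] (ω : I → ℕ) (n : ℕ) :
    Submodule R (Multiset I →₀ R) :=
  Finsupp.supported R R {s | n ≤ (s.map ω).sum}

lemma mulVar_mem_weightGE (b : Module.Basis J R L) (e : J → I) (ω : I → ℕ)
    {p m : ℕ} {x : L} (hx : x ∈ basisGE b e ω p) {v : Multiset I →₀ R}
    (hv : v ∈ weightGE R ω m) : mulVar b e x v ∈ weightGE R ω (p + m) := by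
  refine map_mem_of_mem_basisGE b e ω ((mulVar b e).flip v) _ (fun j hj => ?_) hx
  refine map_mem_of_mem_supported (mulVar b e (b j)) _ (fun s hs => ?_) hv
  rw [mulVar_basis]
  refine Finsupp.single_mem_supported R 1 ?_
  simp only [Set.mem_ofPred_eq, Multiset.map_cons, Multiset.sum_cons] at hs ⊢
  omega

variable [LinearOrder J]

/-- The index `j` is at most every index of `J` that occurs in the monomial `s`. -/
def IsLow (e : J → I) (j : J) (s : Multiset I) : Prop := ∀ k, e k ∈ s → j ≤ k

lemma IsLow.cons {e : J → I} (he : Function.Injective e) {j k : J} {s : Multiset I}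
    (h : IsLow e j s) (hjk : j ≤ k) : IsLow e j (e k ::ₘ s) := by
  intro l hl
  rcases Multiset.mem_cons.1 hl with hl | hl
  · exact he hl ▸ hjk
  · exact h l hl

lemma IsLow.of_cons {e : J → I} {j : J} {i : I} {s : Multiset I} (h : IsLow e j (i ::ₘ s)) :
    IsLow e j s := fun k hk => h k (Multiset.mem_cons_of_mem hk)

lemma exists_isLow_lt (e : J → I) (he : Function.Injective e) {j : J} {s : Multiset I}
    (h : ¬ IsLow e j s) : ∃ k t, k < j ∧ IsLow e k s ∧ s = e k ::ₘ t := by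
  classical
  simp only [IsLow, not_forall, not_le] at h
  obtain ⟨l, hl, hlj⟩ := h
  have hfin : {k | e k ∈ s}.Finite :=
    (s.toFinset.finite_toSet.preimage he.injOn).subset fun k hk => by simpa using hk
  obtain ⟨k, hk, hmin⟩ := Set.exists_min_image {k | e k ∈ s} id hfin ⟨l, hl⟩
  obtain ⟨t, ht⟩ := Multiset.exists_cons_of_mem hk
  exact ⟨k, t, (hmin l hl).trans_lt hlj, hmin, ht⟩

open Classical in
/-- Approximations of the action of `L` on its enveloping algebra, written in the basis of ordered
monomials; the `n`-th one is correct on monomials of degree at most `n`. -/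
noncomputable def approx (b : Module.Basis J R L) (e : J → I) :
    ℕ → L →ₗ[R] Module.End R (Multiset I →₀ R)
  | 0 => mulVar b e
  | n + 1 => b.constr R fun j => Finsupp.linearCombination R fun s =>
      -- For `s = x_k t` with `k < j` least, the rule is `b_j b_k t = b_k b_j t + [b_j, b_k] t`. The
      -- part `b_k (x_j t)` is the plain product `x_j x_k t`, since `k` is low there; the recursion
      -- therefore only meets `b_j t - x_j t` and `t`, of degree at most that of `t`.
      if h : ∃ p : J × Multiset I, p.1 < j ∧ IsLow e p.1 s ∧ s = e p.1 ::ₘ p.2 then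
        mulVar b e (b j) (Finsupp.single s 1) +
          approx b e n (b h.choose.1) (approx b e n (b j) (Finsupp.single h.choose.2 1) -
            mulVar b e (b j) (Finsupp.single h.choose.2 1)) +
          approx b e n ⁅b j, b h.choose.1⁆ (Finsupp.single h.choose.2 1)
      else mulVar b e (b j) (Finsupp.single s 1)

variable (b : Module.Basis J R L) (e : J → I)

lemma approx_low (n : ℕ) {j : J} {s : Multiset I} (h : IsLow e j s) :
    approx b e n (b j) (Finsupp.single s 1) = Finsupp.single (e j ::ₘ s) 1 := by
  cases n with
  | zero => exact mulVar_basis b e j s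
  | succ n =>
    have hn : ¬ ∃ p : J × Multiset I, p.1 < j ∧ IsLow e p.1 s ∧ s = e p.1 ::ₘ p.2 := by
      rintro ⟨p, hp, -, rfl⟩
      exact (h p.1 (Multiset.mem_cons_self _ _)).not_gt hp
    simp only [approx, Module.Basis.constr_basis, Finsupp.linearCombination_single, one_smul,
      dif_neg hn, mulVar_basis]

lemma approx_cons (n : ℕ) {j k : J} {t : Multiset I} (hkj : k < j) (h : IsLow e k (e k ::ₘ t)) :
    approx b e (n + 1) (b j) (Finsupp.single (e k ::ₘ t) 1) =
      mulVar b e (b j) (Finsupp.single (e k ::ₘ t) 1) +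
        approx b e n (b k) (approx b e n (b j) (Finsupp.single t 1) -
          mulVar b e (b j) (Finsupp.single t 1)) +
        approx b e n ⁅b j, b k⁆ (Finsupp.single t 1) := by
  have hp : ∃ p : J × Multiset I,
      p.1 < j ∧ IsLow e p.1 (e k ::ₘ t) ∧ e k ::ₘ t = e p.1 ::ₘ p.2 := ⟨(k, t), hkj, h, rfl⟩
  -- The choice is harmless: `k` is the least index of `J` in the monomial, and it determines `t`.
  have key : hp.choose = (k, t) := by
    obtain ⟨-, h2, h3⟩ := hp.choose_spec
    generalize hp.choose = q at h2 h3
    obtain ⟨l, u⟩ := q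
    have hl : l = k := le_antisymm (h2 k (Multiset.mem_cons_self _ _))
      (h l (by rw [h3]; exact Multiset.mem_cons_self _ _))
    subst hl
    simp only [Multiset.cons_inj_right] at h3
    rw [h3]
  simp only [approx, Module.Basis.constr_basis, Finsupp.linearCombination_single, one_smul,
    dif_pos hp, key]

variable (he : Function.Injective e)

include he in
/-- Up to terms of lower degree, `approx` is multiplication by linear forms. -/
lemma approx_sub_mulVar_mem (n : ℕ) : ∀ (x : L) {m : ℕ} {v : Multiset I →₀ R},
    v ∈ degLE R I m → approx b e n x v - mulVar b e x v ∈ degLE R I m := by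
  induction n with
  | zero => intro x m v _; simp [approx]
  | succ n ih =>
    have step : ∀ (x : L) {m : ℕ} {v : Multiset I →₀ R}, v ∈ degLE R I m →
        approx b e n x v ∈ degLE R I (m + 1) := fun x m v hv => by
      have := add_mem (degLE_mono m.le_succ (ih x hv)) (mulVar_mem_degLE b e x hv)
      simpa using this
    intro x m v hv
    refine map_mem_of_basis b ((approx b e (n + 1)).flip v - (mulVar b e).flip v) _ (fun j => ?_) x
    refine map_mem_of_mem_supported (approx b e (n + 1) (b j) - mulVar b e (b j)) _
      (fun s hs => ?_) hv
    simp only [LinearMap.sub_apply]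
    by_cases h : IsLow e j s
    · rw [approx_low b e _ h, mulVar_basis, sub_self]; exact zero_mem _
    · obtain ⟨k, t, hkj, hk, rfl⟩ := exists_isLow_lt e he h
      have ht : t.card + 1 ≤ m := by simpa using hs
      rw [approx_cons b e n hkj hk, add_assoc, add_sub_cancel_left]
      have hs1 := single_mem_degLE (R := R) (le_refl t.card)
      exact degLE_mono ht (add_mem (step _ (ih _ hs1)) (step _ hs1))

include he in
-- In degree `n + 1` all recursive calls have arguments of degree at most `n`, where consecutive
-- approximations already agree.
lemma approx_succ_eq (n : ℕ) : ∀ (x : L) {v : Multiset I →₀ R},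
    v ∈ degLE R I n → approx b e (n + 1) x v = approx b e n x v := by
  have red : ∀ n, (∀ j (s : Multiset I), s.card ≤ n →
      approx b e (n + 1) (b j) (Finsupp.single s 1) = approx b e n (b j) (Finsupp.single s 1)) →
      ∀ (x : L) {v : Multiset I →₀ R}, v ∈ degLE R I n →
        approx b e (n + 1) x v = approx b e n x v := fun n h x v hv => by
    rw [← sub_eq_zero, ← Submodule.mem_bot R]
    refine map_mem_of_basis b ((approx b e (n + 1)).flip v - (approx b e n).flip v) _ (fun j => ?_) x
    refine map_mem_of_mem_supported (approx b e (n + 1) (b j) - approx b e n (b j)) _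
      (fun s hs => ?_) hv
    simp [h j s hs]
  induction n with
  | zero =>
    refine red 0 fun j s hs => ?_
    obtain rfl : s = 0 := by simpa using hs
    have h0 : IsLow e j (0 : Multiset I) := fun k hk => by simp at hk
    rw [approx_low b e _ h0, approx_low b e _ h0]
  | succ n ih =>
    refine red (n + 1) fun j s hs => ?_
    by_cases h : IsLow e j s
    · rw [approx_low b e _ h, approx_low b e _ h]
    · obtain ⟨k, t, hkj, hk, rfl⟩ := exists_isLow_lt e he h
      have ht : t.card ≤ n := by simpa using hs
      have hs1 := single_mem_degLE (R := R) ht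
      rw [approx_cons b e _ hkj hk, approx_cons b e _ hkj hk, ih _ hs1, ih _ hs1,
        ih _ (approx_sub_mulVar_mem b e he n _ hs1)]

include he in
lemma approx_eq_of_le {n m : ℕ} (h : n ≤ m) (x : L) {v : Multiset I →₀ R}
    (hv : v ∈ degLE R I n) : approx b e m x v = approx b e n x v := by
  induction m, h using Nat.le_induction with
  | base => rfl
  | succ m hm ih => rw [approx_succ_eq b e he m x (degLE_mono hm hv), ih]

/-- The action of `L` on its enveloping algebra, written in the basis of ordered monomials. The
variables outside of the range of `e` are inert. -/
noncomputable def action : L →ₗ[R] Module.End R (Multiset I →₀ R) :=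
  b.constr R fun j => Finsupp.linearCombination R fun s =>
    approx b e s.card (b j) (Finsupp.single s 1)

include he in
lemma action_eq_approx {n : ℕ} (x : L) {v : Multiset I →₀ R} (hv : v ∈ degLE R I n) :
    action b e x v = approx b e n x v := by
  rw [← sub_eq_zero, ← Submodule.mem_bot R]
  refine map_mem_of_basis b ((action b e).flip v - (approx b e n).flip v) _ (fun j => ?_) x
  refine map_mem_of_mem_supported (action b e (b j) - approx b e n (b j)) _ (fun s hs => ?_) hv
  have := approx_eq_of_le b e he hs (b j) (single_mem_degLE (R := R) (le_refl s.card))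
  simp [this, action]

lemma action_low {j : J} {s : Multiset I} (h : IsLow e j s) :
    action b e (b j) (Finsupp.single s 1) = Finsupp.single (e j ::ₘ s) 1 := by
  simp [action, approx_low b e _ h]

include he in
lemma action_sub_mulVar_mem (x : L) {n : ℕ} {v : Multiset I →₀ R} (hv : v ∈ degLE R I n) :
    action b e x v - mulVar b e x v ∈ degLE R I n := by
  rw [action_eq_approx b e he x hv]
  exact approx_sub_mulVar_mem b e he n x hv

include he in
-- This is the recursion of `approx` with the leading term `x_j t` put back: `b_k` acts on it by
-- multiplication, which cancels the correction.
lemma action_cons {j k : J} {t : Multiset I} (hkj : k < j) (h : IsLow e k (e k ::ₘ t)) :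
    action b e (b j) (Finsupp.single (e k ::ₘ t) 1) =
      action b e (b k) (action b e (b j) (Finsupp.single t 1)) +
        action b e ⁅b j, b k⁆ (Finsupp.single t 1) := by
  have ht := single_mem_degLE (R := R) (le_refl t.card)
  have hkt := single_mem_degLE (R := R) (s := e k ::ₘ t) (n := t.card + 1) (by simp)
  have hlow : action b e (b k) (mulVar b e (b j) (Finsupp.single t 1)) =
      mulVar b e (b j) (Finsupp.single (e k ::ₘ t) 1) := by
    rw [mulVar_basis, mulVar_basis, action_low b e (h.of_cons.cons he hkj.le), Multiset.cons_swap]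
  rw [action_eq_approx b e he _ hkt, approx_cons b e _ hkj h, ← action_eq_approx b e he _ ht,
    ← action_eq_approx b e he _ ht,
    ← action_eq_approx b e he _ (action_sub_mulVar_mem b e he _ ht), map_sub, hlow]
  abel

include he in
/-- The commutation rule for `action`, on polynomials of bounded degree. -/
lemma action_lie_apply (n : ℕ) : ∀ (x y : L) {v : Multiset I →₀ R}, v ∈ degLE R I n →
    action b e x (action b e y v) =
      action b e y (action b e x v) + action b e ⁅x, y⁆ v := by
  let ρ := action b e
  -- The defect of the commutation rule is bilinear and antisymmetric, so basis elements `b j`, `b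
  -- k` with `k < j` suffice.
  let Δ : L →ₗ[R] L →ₗ[R] Module.End R (Multiset I →₀ R) := LinearMap.mk₂ R
    (fun x y => ρ x * ρ y - (ρ y * ρ x + ρ ⁅x, y⁆))
    (fun x x' y => by simp only [map_add, add_lie]; noncomm_ring)
    (fun c x y => by
      simp only [map_smul, smul_lie, smul_mul_assoc, mul_smul_comm]; module)
    (fun x y y' => by simp only [map_add, lie_add]; noncomm_ring)
    (fun c x y => by
      simp only [map_smul, lie_smul, smul_mul_assoc, mul_smul_comm]; module)
  have hΔ : ∀ x y v, Δ x y v = ρ x (ρ y v) - (ρ y (ρ x v) + ρ ⁅x, y⁆ v) := fun x y v => rfl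
  have red : ∀ n, (∀ j k (s : Multiset I), s.card ≤ n → k < j →
      Δ (b j) (b k) (Finsupp.single s 1) = 0) →
      ∀ (x y : L) {v : Multiset I →₀ R}, v ∈ degLE R I n →
        ρ x (ρ y v) = ρ y (ρ x v) + ρ ⁅x, y⁆ v := fun n h x y v hv => by
    rw [← sub_eq_zero, ← hΔ, ← Submodule.mem_bot R]
    refine map_mem_of_basis b ((Δ.flip y).flip v) _ (fun j => ?_) x
    refine map_mem_of_basis b ((Δ (b j)).flip v) _ (fun k => ?_) y
    refine map_mem_of_mem_supported (Δ (b j) (b k)) _ (fun s hs => ?_) hv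
    rw [Submodule.mem_bot]
    rcases lt_trichotomy j k with hjk | rfl | hkj
    · have h1 := h k j s hs hjk
      rw [hΔ] at h1 ⊢
      rw [← lie_skew, map_neg, LinearMap.neg_apply] at h1
      rw [← neg_eq_zero, ← h1]
      abel
    · simp [hΔ]
    · exact h j k s hs hkj
  have low : ∀ j k (s : Multiset I), k < j → IsLow e k s →
      ρ (b j) (ρ (b k) (Finsupp.single s 1)) =
        ρ (b k) (ρ (b j) (Finsupp.single s 1)) + ρ ⁅b j, b k⁆ (Finsupp.single s 1) :=
    fun j k s hkj h => by
      rw [show ρ (b k) (Finsupp.single s 1) = _ from action_low b e h]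
      exact action_cons b e he hkj (h.cons he le_rfl)
  induction n with
  | zero =>
    refine red 0 fun j k s hs hkj => ?_
    obtain rfl : s = 0 := by simpa using hs
    rw [hΔ, sub_eq_zero]
    exact low j k 0 hkj fun l hl => by simp at hl
  | succ n ih =>
    refine red (n + 1) fun j k s hs hkj => ?_
    rw [hΔ, sub_eq_zero]
    by_cases h : IsLow e k s
    · exact low j k s hkj h
    · obtain ⟨l, t, hlk, hl, rfl⟩ := exists_isLow_lt e he h
      have ht := single_mem_degLE (R := R) (s := t) (n := n) (by simpa using hs)
      have hlj := hlk.trans hkj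
      -- The induction hypothesis covers only degree `n`, while `b_i' t` has degree up to `n + 1`.
      -- Its leading term `x_i' t` is a monomial on which `l` is low, so the defining rule applies;
      -- the remainder has degree at most `n`.
      have aux : ∀ i i', l < i → l < i' →
          ρ (b i) (ρ (b l) (ρ (b i') (Finsupp.single t 1))) =
            ρ (b l) (ρ (b i) (ρ (b i') (Finsupp.single t 1))) +
              ρ ⁅b i, b l⁆ (ρ (b i') (Finsupp.single t 1)) := fun i i' hi hi' => by
        have hw := ih (b i) (b l) (action_sub_mulVar_mem b e he (b i') ht)
        have hm := low i l (e i' ::ₘ t) hi (hl.of_cons.cons he hi'.le)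
        rw [mulVar_basis] at hw
        rw [show ρ (b i') (Finsupp.single t 1) = (ρ (b i') (Finsupp.single t 1) -
          Finsupp.single (e i' ::ₘ t) 1) + Finsupp.single (e i' ::ₘ t) 1 by abel]
        simp only [map_add] at hw hm ⊢
        rw [hw, hm]
        abel
      have hlt : ρ (b l) (Finsupp.single t 1) = Finsupp.single (e l ::ₘ t) 1 :=
        action_low b e hl.of_cons
      rw [← hlt]
      rw [show ρ (b k) (ρ (b l) (Finsupp.single t 1)) = _ from ih _ _ ht,
        show ρ (b j) (ρ (b l) (Finsupp.single t 1)) = _ from ih _ _ ht,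
        show ρ ⁅b j, b k⁆ (ρ (b l) (Finsupp.single t 1)) = _ from ih _ _ ht]
      -- With `b_l` moved to the left everywhere, the two sides differ by the Jacobi identity.
      rw [map_add, map_add, aux j k hlj hlk, aux k j hlk hlj,
        show ρ (b j) (ρ (b k) (Finsupp.single t 1)) = _ from ih _ _ ht,
        show ρ (b j) (ρ ⁅b k, b l⁆ (Finsupp.single t 1)) = _ from ih _ _ ht,
        show ρ (b k) (ρ ⁅b j, b l⁆ (Finsupp.single t 1)) = _ from ih _ _ ht,
        lie_lie (b j) (b k) (b l)]
      simp only [map_add, map_sub, LinearMap.sub_apply]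
      abel

include he in
lemma action_lie (x y : L) : action b e ⁅x, y⁆ = ⁅action b e x, action b e y⁆ := by
  refine Finsupp.lhom_ext' fun s => LinearMap.ext_ring ?_
  change action b e ⁅x, y⁆ (Finsupp.single s 1) =
    action b e x (action b e y (Finsupp.single s 1)) -
      action b e y (action b e x (Finsupp.single s 1))
  rw [action_lie_apply b e he s.card x y (single_mem_degLE (le_refl s.card))]
  abel

/-- The action on ordered monomials, as a homomorphism of Lie algebras. -/
noncomputable def actionHom : L →ₗ⁅R⁆ Module.End R (Multiset I →₀ R) :=
  { action b e with map_lie' := action_lie b e he _ _ }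

/-- Every index is low on the empty monomial, so acting on `1` recovers the coordinates of `x`. -/
lemma action_single_zero (x : L) :
    action b e x (Finsupp.single 0 1) =
      Finsupp.mapDomain (fun j => {e j}) (b.repr x) := by
  have h : (action b e).flip (Finsupp.single 0 1) =
      Finsupp.lmapDomain R R (fun j => ({e j} : Multiset I)) ∘ₗ b.repr.toLinearMap := by
    refine b.ext fun j => ?_
    have h0 : IsLow e j (0 : Multiset I) := fun k hk => by simp at hk
    simp [action_low b e h0]
  exact LinearMap.congr_fun h x

/-! ### The action and weights -/

section Weight

variable (ω : I → ℕ)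

lemma weightGE_mono {m n : ℕ} (h : m ≤ n) : weightGE R ω n ≤ weightGE R ω m :=
  Finsupp.supported_mono fun _ hs => le_trans h hs

variable (hω : ∀ j k, ⁅b j, b k⁆ ∈ basisGE b e ω (ω (e j) + ω (e k)))

include he hω in
-- Reordering keeps the weight, and replacing a product `x_j x_k` by the bracket cannot lower it, by
-- `hω`.
lemma approx_mem_weightGE (n : ℕ) : ∀ {p m : ℕ} {x : L}, x ∈ basisGE b e ω p →
    ∀ {v : Multiset I →₀ R}, v ∈ weightGE R ω m → approx b e n x v ∈ weightGE R ω (p + m) := by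
  induction n with
  | zero => intro p m x hx v hv; exact mulVar_mem_weightGE b e ω hx hv
  | succ n ih =>
    intro p m x hx v hv
    refine map_mem_of_mem_basisGE b e ω ((approx b e (n + 1)).flip v) _ (fun j hj => ?_) hx
    refine map_mem_of_mem_supported (approx b e (n + 1) (b j)) _ (fun s hs => ?_) hv
    have hb : ∀ j, b j ∈ basisGE b e ω (ω (e j)) := fun j =>
      Submodule.subset_span ⟨j, le_refl (ω (e j)), rfl⟩
    have single_mem : ∀ s : Multiset I,
        Finsupp.single s (1 : R) ∈ weightGE R ω (s.map ω).sum := fun s =>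
      Finsupp.single_mem_supported R 1 (le_refl (s.map ω).sum)
    have hs' : m ≤ (s.map ω).sum := hs
    have hle : p + m ≤ ω (e j) + (s.map ω).sum := by omega
    refine weightGE_mono ω hle ?_
    by_cases h : IsLow e j s
    · rw [approx_low b e _ h, ← mulVar_basis b e j s]
      exact mulVar_mem_weightGE b e ω (hb j) (single_mem s)
    · obtain ⟨k, t, hkj, hk, rfl⟩ := exists_isLow_lt e he h
      rw [approx_cons b e n hkj hk]
      refine add_mem (add_mem (mulVar_mem_weightGE b e ω (hb j) (single_mem _)) ?_) ?_
      · have := ih (hb k) (sub_mem (ih (hb j) (single_mem t))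
          (mulVar_mem_weightGE b e ω (hb j) (single_mem t)))
        refine weightGE_mono ω ?_ this
        simp only [Multiset.map_cons, Multiset.sum_cons]
        omega
      · refine weightGE_mono ω ?_ (ih (hω j k) (single_mem t))
        simp only [Multiset.map_cons, Multiset.sum_cons]
        omega

include he hω in
lemma action_mem_weightGE {p m : ℕ} {x : L} (hx : x ∈ basisGE b e ω p)
    {v : Multiset I →₀ R} (hv : v ∈ weightGE R ω m) :
    action b e x v ∈ weightGE R ω (p + m) := by
  refine map_mem_of_mem_supported (action b e x) _ (fun s hs => ?_) hv
  rw [action_eq_approx b e he x (single_mem_degLE (le_refl s.card))]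
  exact approx_mem_weightGE b e he ω hω s.card hx (Finsupp.single_mem_supported R 1 hs)

include he in
/-- The action reflects weights, as one sees on the empty monomial. -/
lemma mem_basisGE_of_action_mem {p : ℕ} {x : L}
    (h : action b e x (Finsupp.single 0 1) ∈ weightGE R ω p) : x ∈ basisGE b e ω p := by
  rw [action_single_zero b e, Finsupp.mem_supported] at h
  rw [basisGE, b.mem_span_image]
  intro j hj
  have hinj : Function.Injective fun j => ({e j} : Multiset I) := fun j k hjk =>
    he (Multiset.singleton_inj.1 hjk)
  have h1 : ({e j} : Multiset I) ∈
      (Finsupp.mapDomain (fun j => ({e j} : Multiset I)) (b.repr x)).support := by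
    rw [Finsupp.mem_support_iff, Finsupp.mapDomain_apply hinj]
    exact Finsupp.mem_support_iff.1 hj
  simpa using h h1

end Weight

end

/-! ### Agreement of two actions on a common subalgebra -/

section Compatibility

variable {R C L₁ L₂ K J₁ J₂ I : Type*} [CommRing R] [LieRing C] [LieAlgebra R C] [LieRing L₁]
  [LieAlgebra R L₁] [LieRing L₂] [LieAlgebra R L₂] [LinearOrder K] [LinearOrder J₁]
  [LinearOrder J₂]

lemma isLow_iff {e : J₁ → I} {i : K → J₁} (hi : StrictMono i)
    (hinit : ∀ k j, j ≤ i k → ∃ k', i k' = j) {k : K} {s : Multiset I} :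
    IsLow e (i k) s ↔ ∀ l, e (i l) ∈ s → k ≤ l := by
  refine ⟨fun h l hl => hi.le_iff_le.1 (h _ hl), fun h j hj => ?_⟩
  by_contra hlt
  obtain ⟨l, rfl⟩ := hinit k j (not_le.1 hlt).le
  exact hlt (hi.monotone (h l hj))

/-- The actions of two Lie algebras agree on a common subalgebra that is spanned by initial
segments of both bases. -/
lemma action_eq_action (bC : Module.Basis K R C) (b₁ : Module.Basis J₁ R L₁)
    (b₂ : Module.Basis J₂ R L₂) {e₁ : J₁ → I} {e₂ : J₂ → I} (he₁ : Function.Injective e₁)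
    (he₂ : Function.Injective e₂) (φ₁ : C →ₗ⁅R⁆ L₁) (φ₂ : C →ₗ⁅R⁆ L₂) {i₁ : K → J₁} {i₂ : K → J₂}
    (hi₁ : StrictMono i₁) (hi₂ : StrictMono i₂) (hinit₁ : ∀ k j, j ≤ i₁ k → ∃ k', i₁ k' = j)
    (hinit₂ : ∀ k j, j ≤ i₂ k → ∃ k', i₂ k' = j) (h₁ : ∀ k, b₁ (i₁ k) = φ₁ (bC k))
    (h₂ : ∀ k, b₂ (i₂ k) = φ₂ (bC k)) (h₁₂ : ∀ k, e₁ (i₁ k) = e₂ (i₂ k)) (x : C) :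
    action b₁ e₁ (φ₁ x) = action b₂ e₂ (φ₂ x) := by
  have key : ∀ (n : ℕ) (x : C) {v : Multiset I →₀ R}, v ∈ degLE R I n →
      action b₁ e₁ (φ₁ x) v = action b₂ e₂ (φ₂ x) v := by
    intro n
    induction n using Nat.strong_induction_on with
    | _ n ih =>
    intro x v hv
    rw [← sub_eq_zero, ← Submodule.mem_bot R]
    refine map_mem_of_basis bC
      ((action b₁ e₁).flip v ∘ₗ φ₁.toLinearMap - (action b₂ e₂).flip v ∘ₗ φ₂.toLinearMap) _
      (fun k => ?_) x
    refine map_mem_of_mem_supported (action b₁ e₁ (φ₁ (bC k)) - action b₂ e₂ (φ₂ (bC k))) _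
      (fun s hs => ?_) hv
    rw [Submodule.mem_bot, LinearMap.sub_apply, sub_eq_zero, ← h₁, ← h₂]
    -- Being low for an index of `K` depends only on the variables of `K`, which both sides share.
    have hlow : ∀ {k s}, IsLow e₁ (i₁ k) s ↔ IsLow e₂ (i₂ k) s := fun {k s} => by
      rw [isLow_iff hi₁ hinit₁, isLow_iff hi₂ hinit₂]
      simp only [h₁₂]
    by_cases h : IsLow e₁ (i₁ k) s
    · rw [action_low b₁ e₁ h, action_low b₂ e₂ (hlow.1 h), h₁₂]
    · obtain ⟨j, t, hjk, hj, rfl⟩ := exists_isLow_lt e₁ he₁ h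
      obtain ⟨l, rfl⟩ := hinit₁ k j hjk.le
      have hlk := hi₁.lt_iff_lt.1 hjk
      have ht := single_mem_degLE (R := R) (le_refl t.card)
      have htn : t.card < n := by simpa [Nat.succ_le_iff] using hs
      have hl₁ := action_low (R := R) b₁ e₁ (hj.of_cons.cons he₁ hjk.le)
      rw [h₁₂ l] at hj ⊢
      have hj₂ := hlow.1 hj
      have hl₂ := action_low (R := R) b₂ e₂ (hj₂.of_cons.cons he₂ (hi₂ hlk).le)
      rw [action_cons b₂ e₂ he₂ (hi₂ hlk) hj₂, ← h₁₂ l,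
        action_cons b₁ e₁ he₁ hjk (by rwa [h₁₂ l])]
      have hw := action_sub_mulVar_mem b₂ e₂ he₂ (b₂ (i₂ k)) ht
      rw [mulVar_basis] at hw
      have h3 := ih _ htn (bC l) hw
      have h4 := ih _ htn (bC k) ht
      have h5 := ih _ htn ⁅bC k, bC l⁆ ht
      simp only [LieHom.map_lie, ← h₁, ← h₂, map_sub] at h3 h4 h5
      rw [h4, h5]
      -- The leading term `x_k t` may have degree `n`, out of reach of the induction; but `l` is low
      -- on it, so both actions are multiplication.
      have h6 : action b₁ e₁ (b₁ (i₁ l)) (Finsupp.single (e₂ (i₂ k) ::ₘ t) 1) =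
          action b₂ e₂ (b₂ (i₂ l)) (Finsupp.single (e₂ (i₂ k) ::ₘ t) 1) := by
        rw [hl₂, ← h₁₂ k, hl₁, h₁₂ l]
      rw [h6, sub_left_inj] at h3
      rw [h3]
  refine Finsupp.lhom_ext' fun s => LinearMap.ext_ring ?_
  exact key s.card x (single_mem_degLE le_rfl)

end Compatibility

end PBW

/-! ### Bases adapted to a filtration -/

section Adapted

variable {F U V K : Type*} [Field F] [AddCommGroup U] [Module F U] [AddCommGroup V] [Module F V]

/-- A linearly independent set that is adapted to a finite filtration on its span extends to a
linearly independent set that is adapted to the filtration. -/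
lemma exists_adapted_superset {P : ℕ → Submodule F V} (hP : Antitone P) (h0 : P 0 = ⊤) {N : ℕ}
    (hN : P N = ⊥) {s : Set V} (hs : LinearIndepOn F id s)
    (hsP : ∀ n, Submodule.span F s ⊓ P n ≤ Submodule.span F (s ∩ P n)) :
    ∃ t, s ⊆ t ∧ LinearIndepOn F id t ∧ ∀ n, P n ≤ Submodule.span F (t ∩ P n) := by
  -- Descending induction on the filtration: `t` is a basis of `P n`, adapted to the later terms,
  -- that contains `s ∩ P n`.
  have key : ∀ m n, m + n = N → ∃ t, s ∩ P n ⊆ t ∧ t ⊆ P n ∧ LinearIndepOn F id t ∧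
      ∀ k, n ≤ k → P k ≤ Submodule.span F (t ∩ P k) := by
    intro m
    induction m with
    | zero =>
      rintro n hn
      obtain rfl : n = N := by omega
      refine ⟨∅, fun x hx => ?_, Set.empty_subset _, linearIndepOn_empty F id, fun k hk => ?_⟩
      · have hx0 : x = 0 := by simpa [hN] using hx.2
        exact (hs.zero_notMem_image (by simpa [hx0] using hx.1)).elim
      · exact (hP hk).trans (hN.le.trans bot_le)
    | succ m ih =>
      intro n hn
      obtain ⟨t, hst, htP, ht, hspan⟩ := ih (n + 1) (by omega)
      have hspan_t : Submodule.span F t = P (n + 1) :=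
        le_antisymm (Submodule.span_le.2 htP)
          ((hspan (n + 1) le_rfl).trans (Submodule.span_mono Set.inter_subset_left))
      -- By `hsP`, an element of `P (n + 1)` in the span of `s \ P (n + 1)` also lies in the span of
      -- `s ∩ P (n + 1)`, so it is zero by independence of `s`.
      have hd : Disjoint (Submodule.span F t) (Submodule.span F (s \ P (n + 1))) := by
        rw [hspan_t]
        have h1 : LinearIndepOn F id ((s ∩ P (n + 1)) ∪ (s \ P (n + 1))) := by
          rwa [Set.inter_union_sdiff]
        have h2 := ((linearIndepOn_union_iff (Set.disjoint_sdiff_inter.symm)).1 h1).2.2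
        simp only [Set.image_id] at h2
        rw [Submodule.disjoint_def] at h2 ⊢
        exact fun x hx hx' => h2 x
          (hsP _ ⟨Submodule.span_mono Set.sdiff_subset hx', hx⟩) hx'
      have hr : LinearIndepOn F id (t ∪ ((s ∩ P n) \ P (n + 1))) := by
        have hsub : (s ∩ P n) \ P (n + 1) ⊆ s \ P (n + 1) :=
          Set.sdiff_subset_sdiff_left Set.inter_subset_left
        refine ht.union (hs.mono (hsub.trans Set.sdiff_subset)) ?_
        simp only [Set.image_id]
        exact hd.mono_right (Submodule.span_mono hsub)
      have hrP : t ∪ ((s ∩ P n) \ P (n + 1)) ⊆ P n :=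
        Set.union_subset (htP.trans (hP n.le_succ)) (Set.sdiff_subset.trans Set.inter_subset_right)
      obtain ⟨u, huP, hru, hPu, hu⟩ := exists_linearIndepOn_id_extension hr hrP
      have htu : t ⊆ u := Set.subset_union_left.trans hru
      refine ⟨u, fun x hx => ?_, huP, hu, fun k hk => ?_⟩
      · by_cases hx1 : x ∈ P (n + 1)
        · exact htu (hst ⟨hx.1, hx1⟩)
        · exact hru (Or.inr ⟨hx, hx1⟩)
      · rcases hk.eq_or_lt with rfl | hk
        · rwa [Set.inter_eq_left.2 huP]
        · exact (hspan k hk).trans (Submodule.span_mono (Set.inter_subset_inter_left _ htu))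
  obtain ⟨t, hst, -, ht, hspan⟩ := key N 0 (by omega)
  exact ⟨t, by simpa [h0] using hst, ht, fun n => hspan n n.zero_le⟩

/-- A basis with a weight function is adapted to a filtration if the elements of weight at least
`n` span its `n`-th term. -/
def IsAdapted {J : Type*} (P : ℕ → Submodule F V) (b : Module.Basis J F V) (w : J → ℕ) : Prop :=
  ∀ n, P n = Submodule.span F (b '' {j | n ≤ w j})

lemma IsAdapted.mem_iff {J : Type*} {P : ℕ → Submodule F V} {b : Module.Basis J F V} {w : J → ℕ}
    (h : IsAdapted P b w) {j : J} {n : ℕ} : b j ∈ P n ↔ n ≤ w j := by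
  rw [h n, b.mem_span_image]
  simp

lemma IsAdapted.reindex {J J' : Type*} {P : ℕ → Submodule F V} {b : Module.Basis J F V}
    {w : J → ℕ} (h : IsAdapted P b w) (σ : J ≃ J') : IsAdapted P (b.reindex σ) (w ∘ σ.symm) := by
  intro n
  rw [h n]
  congr 1
  ext x
  constructor
  · rintro ⟨j, hj, rfl⟩
    exact ⟨σ j, by simpa using hj, by simp⟩
  · rintro ⟨j, hj, rfl⟩
    exact ⟨σ.symm j, hj, by simp⟩

lemma exists_weight {P : ℕ → Submodule F V} (hP : Antitone P) (h0 : P 0 = ⊤) {c : ℕ}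
    (hc : ∀ n, c < n → P n = ⊥) : ∃ w : V → ℕ, ∀ x, x ≠ 0 → ∀ n, x ∈ P n ↔ n ≤ w x := by
  classical
  -- The weight is the last term containing `x`. Zero lies in every term and must be excluded.
  refine ⟨fun x => Nat.findGreatest (fun n => x ∈ P n) c, fun x hx n => ⟨fun h => ?_, fun h => ?_⟩⟩
  · refine Nat.le_findGreatest ?_ h
    by_contra hn
    rw [hc n (not_le.1 hn)] at h
    exact hx (by simpa using h)
  · exact hP h (Nat.findGreatest_spec (P := fun n => x ∈ P n) (zero_le (a := c)) (by simp [h0]))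

universe v in
/-- An adapted basis of a subspace extends to an adapted basis. -/
lemma exists_adapted_extension {V : Type v} [AddCommGroup V] [Module F V]
    {PU : ℕ → Submodule F U} {PV : ℕ → Submodule F V}
    (hP : Antitone PV) (h0 : PV 0 = ⊤) {c : ℕ} (hc : ∀ n, c < n → PV n = ⊥) (f : U →ₗ[F] V)
    (hf : Function.Injective f) (hfP : ∀ n x, x ∈ PU n ↔ f x ∈ PV n) {b : Module.Basis K F U}
    {w : K → ℕ} (hb : IsAdapted PU b w) :
    ∃ (κ : Type v) (b' : Module.Basis (K ⊕ κ) F V) (w' : κ → ℕ),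
      (∀ k, b' (Sum.inl k) = f (b k)) ∧ IsAdapted PV b' (Sum.elim w w') := by
  have hfb : LinearIndependent F (f ∘ b) := b.linearIndependent.map' f (LinearMap.ker_eq_bot.2 hf)
  have hs : LinearIndepOn F id (Set.range (f ∘ b)) := hfb.linearIndepOn_id
  -- The image basis is adapted on its span because `f` reflects the filtration, not merely
  -- preserves it.
  obtain ⟨t, hst, ht, htP⟩ := exists_adapted_superset hP h0 (hc (c + 1) c.lt_succ_self) hs (by
    rintro n x ⟨hx, hxn⟩
    rw [Set.range_comp, Submodule.span_image, b.span_eq] at hx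
    obtain ⟨y, -, rfl⟩ := hx
    have hy : y ∈ PU n := (hfP n y).2 hxn
    rw [hb n] at hy
    have h1 : f y ∈ Submodule.span F (f '' (b '' {j | n ≤ w j})) := by
      rw [Submodule.span_image]
      exact Submodule.mem_map_of_mem hy
    refine Submodule.span_mono ?_ h1
    rintro _ ⟨_, ⟨j, hj, rfl⟩, rfl⟩
    exact ⟨⟨j, rfl⟩, (hfP n _).1 (hb.mem_iff.2 hj)⟩)
  obtain ⟨wt, hwt⟩ := exists_weight hP h0 hc
  let κ := ↥(t \ Set.range (f ∘ b))
  let v : K ⊕ κ → V := Sum.elim (f ∘ b) Subtype.val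
  have hrange : Set.range v = t := by
    rw [Set.Sum.elim_range, Subtype.range_coe, Set.union_sdiff_cancel hst]
  have hv : LinearIndependent F v := by
    have h1 : LinearIndepOn F id (Set.range (f ∘ b) ∪ (t \ Set.range (f ∘ b))) := by
      rwa [Set.union_sdiff_cancel hst]
    have h2 := (linearIndepOn_union_iff Set.disjoint_sdiff_right).1 h1
    refine LinearIndependent.sum_type hfb h2.2.1 ?_
    rw [Subtype.range_coe]
    simpa only [Set.image_id] using h2.2.2
  have hspan : ⊤ ≤ Submodule.span F (Set.range v) := by
    rw [hrange, ← h0]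
    exact (htP 0).trans (Submodule.span_mono Set.inter_subset_left)
  have hmem : ∀ j n, v j ∈ PV n ↔ n ≤ Sum.elim w (fun k : κ => wt k) j := by
    rintro (j | j) n
    · exact (hfP n _).symm.trans hb.mem_iff
    · exact hwt _ (hv.ne_zero (Sum.inr j)) n
  refine ⟨κ, Module.Basis.mk hv hspan, fun k => wt k, fun k => by simp [v], fun n => ?_⟩
  rw [Module.Basis.coe_mk]
  apply le_antisymm
  · refine (htP n).trans (Submodule.span_mono ?_)
    rintro x ⟨hx, hj⟩
    obtain ⟨j, rfl⟩ := hrange.ge hx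
    exact ⟨j, (hmem j n).1 hj, rfl⟩
  · rw [Submodule.span_le]
    rintro _ ⟨j, hj, rfl⟩
    exact (hmem j n).2 hj

end Adapted

/-! ### Endomorphisms filtered by weight -/

namespace PBW

section

variable {R : Type*} [CommRing R] {I : Type*}

/-- The endomorphisms that raise weights by at least `n`. -/
def endGE (R : Type*) [CommRing R] {I : Type*} (ω : I → ℕ) (n : ℕ) :
    Submodule R (Module.End R (Multiset I →₀ R)) where
  carrier := {T | ∀ m, ∀ v ∈ weightGE R ω m, T v ∈ weightGE R ω (n + m)}
  add_mem' hS hT m v hv := add_mem (hS m v hv) (hT m v hv)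
  zero_mem' _ _ _ := zero_mem _
  smul_mem' r _ hT m v hv := Submodule.smul_mem _ r (hT m v hv)

variable (ω : I → ℕ)

lemma single_zero_mem_weightGE : Finsupp.single 0 1 ∈ weightGE R ω 0 :=
  Finsupp.single_mem_supported R 1 (Nat.zero_le (Multiset.sum _))

lemma endGE_antitone : Antitone (endGE R ω) := fun _ _ h _ hT m v hv =>
  weightGE_mono ω (Nat.add_le_add_right h m) (hT m v hv)

lemma lie_mem_endGE {m n : ℕ} {S T : Module.End R (Multiset I →₀ R)} (hS : S ∈ endGE R ω m)
    (hT : T ∈ endGE R ω n) : ⁅S, T⁆ ∈ endGE R ω (m + n) := by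
  intro k v hv
  change S (T v) - T (S v) ∈ _
  refine sub_mem ?_ ?_
  · rw [add_assoc]
    exact hS _ _ (hT k v hv)
  · rw [add_comm m, add_assoc]
    exact hT _ _ (hS k v hv)

end

/-- The action in an adapted basis preserves and reflects the terms of the series. -/
lemma mem_iff_action_mem {F L J I : Type*} [Field F] [LieRing L] [LieAlgebra F L] [LinearOrder J]
    {c : ℕ} (P : LazardSeries F L c) {b : Module.Basis J F L} {e : J → I}
    (he : Function.Injective e) {ω : I → ℕ}
    (hb : IsAdapted (fun n => (P.P n).toSubmodule) b (ω ∘ e)) (n : ℕ) (x : L) :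
    x ∈ P.P n ↔ action b e x ∈ endGE F ω n := by
  have hP : ∀ n x, x ∈ P.P n ↔ x ∈ basisGE b e ω n := fun n x => by
    rw [← LieSubalgebra.mem_toSubmodule]
    exact (Iff.of_eq (congrArg (x ∈ ·) (hb n)))
  refine ⟨fun hx m v hv => ?_, fun hx => ?_⟩
  · refine action_mem_weightGE b e he ω (fun j k => ?_) ((hP n x).1 hx) hv
    rw [← hP]
    exact P.lie_mem _ _ _ _ (hb.mem_iff.2 le_rfl) (hb.mem_iff.2 le_rfl)
  · rw [hP]
    exact mem_basisGE_of_action_mem b e he ω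
      (hx 0 _ (single_zero_mem_weightGE ω))

end PBW

/-! ### A joint representation of the two factors -/

section

open PBW

variable {F : Type u} [Field F] {c : ℕ} {C : Type v₀} [LieRing C] [LieAlgebra F C]
  {A : Type v₁} [LieRing A] [LieAlgebra F A] {B : Type v₂} [LieRing B] [LieAlgebra F B]

lemma LazardSeries.zero_eq_top (P : LazardSeries F A c) : P.P 0 = ⊤ :=
  top_le_iff.1 (P.one_eq_top ▸ P.antitone zero_le_one)

lemma LazardSeries.exists_adapted_extension {K : Type*} {PC : LazardSeries F C c}
    (PA : LazardSeries F A c) {f : C →ₗ⁅F⁆ A} (hf : IsLazardEmbedding PC PA f)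
    {b : Module.Basis K F C} {w : K → ℕ}
    (hb : IsAdapted (fun n => (PC.P n).toSubmodule) b w) :
    ∃ (κ : Type v₁) (b' : Module.Basis (K ⊕ κ) F A) (w' : κ → ℕ),
      (∀ k, b' (Sum.inl k) = f (b k)) ∧
        IsAdapted (fun n => (PA.P n).toSubmodule) b' (Sum.elim w w') :=
  _root_.exists_adapted_extension (PU := fun n => (PC.P n).toSubmodule)
    (PV := fun n => (PA.P n).toSubmodule) (fun _ _ h => PA.antitone h)
    (by simp [PA.zero_eq_top]) (c := c) (fun n hn => by simp [PA.eq_bot_of_lt n hn])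
    f.toLinearMap hf.1 hf.2 hb

lemma LazardSeries.exists_adapted_basis (PC : LazardSeries F C c) :
    ∃ (K : Type v₀) (b : Module.Basis K F C) (w : K → ℕ),
      IsAdapted (fun n => (PC.P n).toSubmodule) b w := by
  -- An adapted basis of `C` extends the empty basis of the zero space.
  obtain ⟨κ, b, w, -, hb⟩ := _root_.exists_adapted_extension (U := PUnit.{v₀ + 1})
    (K := PEmpty.{v₀ + 1}) (PU := fun _ => ⊥)
    (PV := fun n => (PC.P n).toSubmodule) (fun _ _ h => PC.antitone h)
    (by simp [PC.zero_eq_top]) (c := c) (fun n hn => by simp [PC.eq_bot_of_lt n hn])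
    (0 : PUnit.{v₀ + 1} →ₗ[F] C) (Function.injective_of_subsingleton _) (fun n x => by simp)
    (b := Module.Basis.empty _) (w := fun _ => 0) (fun n => Subsingleton.elim _ _)
  exact ⟨_, b, _, hb⟩

lemma Sum.Lex.exists_of_le_inl {α β : Type*} [LinearOrder α] [LinearOrder β] (a : α)
    (x : α ⊕ₗ β) (h : x ≤ toLex (Sum.inl a)) : ∃ a', toLex (Sum.inl a') = x := by
  rcases hx : ofLex x with x' | x'
  · exact ⟨x', hx.symm⟩
  · exact (Sum.Lex.not_inr_le_inl (hx ▸ h : toLex (Sum.inr x') ≤ toLex (Sum.inl a))).elim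

/-- Two Lazard Lie algebras with a common subalgebra act faithfully, compatibly, and strongly on
a common filtered vector space. -/
lemma exists_strong_representation (PC : LazardSeries F C c) (PA : LazardSeries F A c)
    (PB : LazardSeries F B c) {f₀ : C →ₗ⁅F⁆ A} (hf₀ : IsLazardEmbedding PC PA f₀)
    {g₀ : C →ₗ⁅F⁆ B} (hg₀ : IsLazardEmbedding PC PB g₀) :
    ∃ (I : Type (max v₀ v₁ v₂)) (ω : I → ℕ)
      (f : A →ₗ⁅F⁆ Module.End F (Multiset I →₀ F)) (g : B →ₗ⁅F⁆ Module.End F (Multiset I →₀ F)),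
      (∀ x, f (f₀ x) = g (g₀ x)) ∧ (∀ n a, a ∈ PA.P n ↔ f a ∈ endGE F ω n) ∧
      (∀ n b, b ∈ PB.P n ↔ g b ∈ endGE F ω n) ∧
      ∀ a b, f a - g b ∈ endGE F ω (c + 1) → ∃ x, f₀ x = a := by
  obtain ⟨K, bC, w, hC⟩ := PC.exists_adapted_basis
  obtain ⟨κA, bA, wA, hCA, hA⟩ := LazardSeries.exists_adapted_extension PA hf₀ hC
  obtain ⟨κB, bB, wB, hCB, hB⟩ := LazardSeries.exists_adapted_extension PB hg₀ hC
  classical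
  let _ : LinearOrder K := linearOrderOfSTO WellOrderingRel
  let _ : LinearOrder κA := linearOrderOfSTO WellOrderingRel
  let _ : LinearOrder κB := linearOrderOfSTO WellOrderingRel
  -- The lexicographic sums below put `K` first, making the basis of `C` an initial segment of both
  -- bases.
  let I := K ⊕ (κA ⊕ κB)
  let ω : I → ℕ := Sum.elim w (Sum.elim wA wB)
  let eA : K ⊕ₗ κA → I := Sum.map id Sum.inl ∘ ofLex
  let eB : K ⊕ₗ κB → I := Sum.map id Sum.inr ∘ ofLex
  have heA : Function.Injective eA :=
    (Function.injective_id.sumMap Sum.inl_injective).comp ofLex.injective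
  have heB : Function.Injective eB :=
    (Function.injective_id.sumMap Sum.inr_injective).comp ofLex.injective
  let bA' := bA.reindex toLex
  let bB' := bB.reindex toLex
  have hA' : IsAdapted (fun n => (PA.P n).toSubmodule) bA' (ω ∘ eA) := by
    convert hA.reindex toLex using 1
    funext j
    rcases j with j | j <;> rfl
  have hB' : IsAdapted (fun n => (PB.P n).toSubmodule) bB' (ω ∘ eB) := by
    convert hB.reindex toLex using 1
    funext j
    rcases j with j | j <;> rfl
  refine ⟨I, ω, actionHom bA' eA heA, actionHom bB' eB heB, fun x => ?_,
    mem_iff_action_mem PA heA hA', mem_iff_action_mem PB heB hB', fun a b hab => ?_⟩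
  · exact action_eq_action bC bA' bB' heA heB f₀ g₀ (i₁ := toLex ∘ Sum.inl)
      (i₂ := toLex ∘ Sum.inl) Sum.Lex.inl_strictMono Sum.Lex.inl_strictMono
      Sum.Lex.exists_of_le_inl Sum.Lex.exists_of_le_inl (fun k => by simp [bA', hCA])
      (fun k => by simp [bB', hCB]) (fun k => rfl) x
  · have h1 : action bA' eA a (Finsupp.single 0 1) - action bB' eB b (Finsupp.single 0 1) ∈
        weightGE F ω (c + 1) :=
      hab 0 _ (single_zero_mem_weightGE ω)
    rw [action_single_zero, action_single_zero] at h1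
    -- As `P (c + 1) = 0`, this variable has weight at most `c`, so its coefficient in the
    -- difference vanishes; it does not occur in the linear form of `b`.
    have h2 : ∀ k : κA, bA.repr a (Sum.inr k) = 0 := fun k => by
      have hk : wA k < c + 1 := by
        by_contra hk
        have := hA.mem_iff.2 (not_lt.1 hk : c + 1 ≤ Sum.elim w wA (Sum.inr k))
        rw [PA.eq_bot_of_lt _ c.lt_succ_self] at this
        exact bA.ne_zero _ (by simpa using this)
      have hinj : Function.Injective fun j => ({eA j} : Multiset I) := fun j k hjk =>
        heA (Multiset.singleton_inj.1 hjk)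
      have h3 := (Finsupp.mem_supported' F _).1 h1 {eA (toLex (Sum.inr k))}
        (by simpa [eA, ω] using hk)
      rw [Finsupp.sub_apply, Finsupp.mapDomain_apply hinj,
        Finsupp.mapDomain_of_notMem_range, sub_zero] at h3
      · simpa [bA'] using h3
      · rintro ⟨j, hj⟩
        have hj' := Multiset.singleton_inj.1 hj
        rcases j with j | j
        · exact Sum.inl_ne_inr hj'
        · exact Sum.inr_ne_inl (Sum.inr_injective hj')
    have h4 : a ∈ Submodule.span F (bA '' Set.range Sum.inl) := by
      rw [bA.mem_span_image]
      rintro (j | j) hj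
      · exact ⟨j, rfl⟩
      · exact (Finsupp.mem_support_iff.1 hj (h2 j)).elim
    have h5 : Submodule.span F (bA '' Set.range Sum.inl) ≤ LinearMap.range f₀.toLinearMap := by
      rw [Submodule.span_le]
      rintro _ ⟨_, ⟨k, rfl⟩, rfl⟩
      exact ⟨bC k, (hCA k).symm⟩
    exact h5 h4

end

/-! ### Free Lie algebras and quotients -/

lemma FreeLieAlgebra.eq_top_of_forall_of_mem {R X : Type*} [CommRing R]
    (K : LieSubalgebra R (FreeLieAlgebra R X)) (h : ∀ x, FreeLieAlgebra.of R x ∈ K) : K = ⊤ := by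
  have hid : K.incl.comp (FreeLieAlgebra.lift R fun x => (⟨FreeLieAlgebra.of R x, h x⟩ : K)) =
      LieHom.id := by
    refine FreeLieAlgebra.hom_ext fun x => ?_
    simp
  refine eq_top_iff.2 fun x _ => ?_
  have := LieHom.congr_fun hid x
  rw [LieHom.comp_apply, LieHom.id_apply] at this
  rw [← this]
  exact Subtype.coe_prop _

/-- A homomorphism of Lie algebras that vanishes on an ideal factors through the quotient. -/
lemma LieIdeal.exists_quotient_lift {R L M : Type*} [CommRing R] [LieRing L] [LieAlgebra R L]
    [LieRing M] [LieAlgebra R M] (I : LieIdeal R L) (φ : L →ₗ⁅R⁆ M) (h : ∀ x ∈ I, φ x = 0) :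
    ∃ ψ : L ⧸ I →ₗ⁅R⁆ M, ∀ x, ψ (LieSubmodule.Quotient.mk x) = φ x :=
  ⟨{ I.toSubmodule.liftQ φ.toLinearMap h with
      map_lie' := by
        rintro ⟨x⟩ ⟨y⟩
        exact φ.map_lie x y }, fun _ => rfl⟩

/-- The projection to the quotient by an ideal, as a homomorphism of Lie algebras. -/
def LieIdeal.quotientHom {R L : Type*} [CommRing R] [LieRing L] [LieAlgebra R L]
    (I : LieIdeal R L) : L →ₗ⁅R⁆ L ⧸ I :=
  { (LieSubmodule.Quotient.mk' I : L →ₗ[R] L ⧸ I) with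
    map_lie' := fun {x y} => LieSubmodule.Quotient.mk_bracket I x y }

/-! ### The amalgam as a quotient of a free Lie algebra -/

namespace LazardSeries

section

variable {F : Type*} [Field F] {c : ℕ} {C : Type*} [LieRing C] [LieAlgebra F C]
  {A : Type*} [LieRing A] [LieAlgebra F A] {B : Type*} [LieRing B] [LieAlgebra F B]
  (PA : LazardSeries F A c) (PB : LazardSeries F B c) (f₀ : C →ₗ⁅F⁆ A) (g₀ : C →ₗ⁅F⁆ B)

open FreeLieAlgebra (of lift)

/-- The weight of an element of the free Lie algebra on `A ⊕ B` is at least `n`: the filtration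
generated by the series of `A` and `B`, where the relations of the amalgam have infinite weight. -/
inductive Weight : ℕ → FreeLieAlgebra F (A ⊕ B) → Prop
  | inl {n a} : a ∈ PA.P n → Weight n (of F (Sum.inl a))
  | inr {n b} : b ∈ PB.P n → Weight n (of F (Sum.inr b))
  | add_inl (n) (a a' : A) : Weight n (of F (Sum.inl (a + a')) -
      (of F (Sum.inl a) + of F (Sum.inl a')))
  | add_inr (n) (b b' : B) : Weight n (of F (Sum.inr (b + b')) -
      (of F (Sum.inr b) + of F (Sum.inr b')))
  | smul_inl (n) (r : F) (a : A) : Weight n (of F (Sum.inl (r • a)) - r • of F (Sum.inl a))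
  | smul_inr (n) (r : F) (b : B) : Weight n (of F (Sum.inr (r • b)) - r • of F (Sum.inr b))
  | lie_inl (n) (a a' : A) : Weight n (of F (Sum.inl ⁅a, a'⁆) -
      ⁅(of F (Sum.inl a) : FreeLieAlgebra F (A ⊕ B)), of F (Sum.inl a')⁆)
  | lie_inr (n) (b b' : B) : Weight n (of F (Sum.inr ⁅b, b'⁆) -
      ⁅(of F (Sum.inr b) : FreeLieAlgebra F (A ⊕ B)), of F (Sum.inr b')⁆)
  | amalgam (n) (x : C) : Weight n (of F (Sum.inl (f₀ x)) - of F (Sum.inr (g₀ x)))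
  | zero (n) : Weight n 0
  | add {n x y} : Weight n x → Weight n y → Weight n (x + y)
  | smul {n x} (r : F) : Weight n x → Weight n (r • x)
  | lie {m n x y} : Weight m x → Weight n y → Weight (m + n) ⁅x, y⁆
  | mono {m n x} : m ≤ n → Weight n x → Weight m x

variable {PA PB f₀ g₀}

lemma Weight.sub {n : ℕ} {x y : FreeLieAlgebra F (A ⊕ B)} (hx : Weight PA PB f₀ g₀ n x)
    (hy : Weight PA PB f₀ g₀ n y) : Weight PA PB f₀ g₀ n (x - y) := by
  simpa [sub_eq_add_neg] using hx.add (hy.smul (-1))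

/-- A compatible pair of filtered homomorphisms induces a filtered homomorphism. -/
lemma Weight.lift_mem {D : Type*} [LieRing D] [LieAlgebra F D] {Q : ℕ → Submodule F D}
    (hQ : Antitone Q) (hlie : ∀ m n x y, x ∈ Q m → y ∈ Q n → ⁅x, y⁆ ∈ Q (m + n))
    {f : A →ₗ⁅F⁆ D} {g : B →ₗ⁅F⁆ D} (hf : ∀ n a, a ∈ PA.P n → f a ∈ Q n)
    (hg : ∀ n b, b ∈ PB.P n → g b ∈ Q n) (hfg : ∀ x, f (f₀ x) = g (g₀ x)) {n : ℕ}
    {x : FreeLieAlgebra F (A ⊕ B)} (hx : Weight PA PB f₀ g₀ n x) :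
    lift F (Sum.elim f g) x ∈ Q n := by
  induction hx with
  | inl h => simpa using hf _ _ h
  | inr h => simpa using hg _ _ h
  | zero => simp
  | add _ _ ihx ihy => simpa using add_mem ihx ihy
  | smul r _ ih => simpa using Submodule.smul_mem _ r ih
  | lie _ _ ihx ihy => simpa using hlie _ _ _ _ ihx ihy
  | mono h _ ih => exact hQ h ih
  -- The remaining constructors are the relations, which map to zero and hence into every term.
  | _ => simp [hfg]

lemma Weight.one (x : FreeLieAlgebra F (A ⊕ B)) : Weight PA PB f₀ g₀ 1 x := by
  let K : LieSubalgebra F (FreeLieAlgebra F (A ⊕ B)) :=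
    { carrier := {x | Weight PA PB f₀ g₀ 1 x}
      add_mem' := Weight.add
      zero_mem' := Weight.zero 1
      smul_mem' := fun r _ => Weight.smul r
      lie_mem' := fun hx hy => (Weight.lie hx hy).mono one_le_two }
  have hK : K = ⊤ := FreeLieAlgebra.eq_top_of_forall_of_mem K <| by
    rintro (a | b)
    · exact Weight.inl (by simp [PA.one_eq_top])
    · exact Weight.inr (by simp [PB.one_eq_top])
  exact (hK ▸ LieSubalgebra.mem_top x : x ∈ K)

variable (PA PB f₀ g₀)

/-- The ideal of elements of weight more than `c`. -/
def relations : LieIdeal F (FreeLieAlgebra F (A ⊕ B)) where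
  carrier := {x | Weight PA PB f₀ g₀ (c + 1) x}
  add_mem' := Weight.add
  zero_mem' := Weight.zero _
  smul_mem' := fun r _ => Weight.smul r
  lie_mem {x _} hy := ((Weight.one x).lie hy).mono (Nat.le_add_left _ _)

/-- The free amalgam of two Lazard Lie algebras. -/
abbrev Amalgam : Type _ := FreeLieAlgebra F (A ⊕ B) ⧸ relations PA PB f₀ g₀

/-- The projection of the free Lie algebra to the free amalgam. -/
noncomputable def toAmalgam : FreeLieAlgebra F (A ⊕ B) →ₗ⁅F⁆ Amalgam PA PB f₀ g₀ :=
  (relations PA PB f₀ g₀).quotientHom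

lemma toAmalgam_surjective : Function.Surjective (toAmalgam PA PB f₀ g₀) :=
  LieSubmodule.Quotient.surjective_mk' _

variable {PA PB f₀ g₀} in
lemma toAmalgam_eq_iff {x y : FreeLieAlgebra F (A ⊕ B)} :
    toAmalgam PA PB f₀ g₀ x = toAmalgam PA PB f₀ g₀ y ↔ Weight PA PB f₀ g₀ (c + 1) (x - y) :=
  Submodule.Quotient.eq _

/-- The Lazard series of the free amalgam. -/
def amalgamSeries : LazardSeries F (Amalgam PA PB f₀ g₀) c where
  P n :=
    { carrier := {s | ∃ x, Weight PA PB f₀ g₀ n x ∧ toAmalgam PA PB f₀ g₀ x = s}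
      add_mem' := by
        rintro _ _ ⟨x, hx, rfl⟩ ⟨y, hy, rfl⟩
        exact ⟨x + y, hx.add hy, map_add _ x y⟩
      zero_mem' := ⟨0, Weight.zero n, map_zero _⟩
      smul_mem' := by
        rintro r _ ⟨x, hx, rfl⟩
        exact ⟨r • x, hx.smul r, map_smul _ r x⟩
      lie_mem' := by
        rintro _ _ ⟨x, hx, rfl⟩ ⟨y, hy, rfl⟩
        exact ⟨⁅x, y⁆, (hx.lie hy).mono (Nat.le_add_left _ _), LieHom.map_lie _ x y⟩ }
  antitone := by
    rintro m n h _ ⟨x, hx, rfl⟩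
    exact ⟨x, hx.mono h, rfl⟩
  one_eq_top := by
    refine eq_top_iff.2 fun s _ => ?_
    obtain ⟨x, rfl⟩ := toAmalgam_surjective PA PB f₀ g₀ s
    exact ⟨x, Weight.one x, rfl⟩
  eq_bot_of_lt := by
    refine fun n hn => eq_bot_iff.2 ?_
    rintro _ ⟨x, hx, rfl⟩
    rw [LieSubalgebra.mem_bot, ← map_zero (toAmalgam PA PB f₀ g₀), toAmalgam_eq_iff, sub_zero]
    exact hx.mono hn
  lie_mem := by
    rintro m n _ _ ⟨x, hx, rfl⟩ ⟨y, hy, rfl⟩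
    exact ⟨⁅x, y⁆, hx.lie hy, LieHom.map_lie _ x y⟩

variable {PA PB f₀ g₀} in
-- Lifts differ by an element of weight `c + 1`, which is harmless up to `n = c + 1` only.
lemma Weight.of_toAmalgam_mem {n : ℕ} (hn : n ≤ c + 1) {x : FreeLieAlgebra F (A ⊕ B)}
    (h : toAmalgam PA PB f₀ g₀ x ∈ (amalgamSeries PA PB f₀ g₀).P n) :
    Weight PA PB f₀ g₀ n x := by
  obtain ⟨y, hy, hyx⟩ := h
  simpa using hy.sub ((toAmalgam_eq_iff.1 hyx).mono hn)

/-- The first factor of the free amalgam. -/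
noncomputable def amalgamInl : A →ₗ⁅F⁆ Amalgam PA PB f₀ g₀ where
  toFun a := toAmalgam PA PB f₀ g₀ (of F (Sum.inl a))
  map_add' a a' := by
    rw [← map_add, toAmalgam_eq_iff]
    exact Weight.add_inl _ a a'
  map_smul' r a := by
    rw [← map_smul, toAmalgam_eq_iff]
    exact Weight.smul_inl _ r a
  map_lie' {a a'} := by
    rw [← LieHom.map_lie]
    exact toAmalgam_eq_iff.2 (Weight.lie_inl _ a a')

/-- The second factor of the free amalgam. -/
noncomputable def amalgamInr : B →ₗ⁅F⁆ Amalgam PA PB f₀ g₀ where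
  toFun b := toAmalgam PA PB f₀ g₀ (of F (Sum.inr b))
  map_add' b b' := by
    rw [← map_add, toAmalgam_eq_iff]
    exact Weight.add_inr _ b b'
  map_smul' r b := by
    rw [← map_smul, toAmalgam_eq_iff]
    exact Weight.smul_inr _ r b
  map_lie' {b b'} := by
    rw [← LieHom.map_lie]
    exact toAmalgam_eq_iff.2 (Weight.lie_inr _ b b')

lemma amalgamInl_apply (a : A) :
    amalgamInl PA PB f₀ g₀ a = toAmalgam PA PB f₀ g₀ (of F (Sum.inl a)) := rfl

lemma amalgamInr_apply (b : B) :
    amalgamInr PA PB f₀ g₀ b = toAmalgam PA PB f₀ g₀ (of F (Sum.inr b)) := rfl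

/-- A homomorphism to the free amalgam is an embedding if it preserves the series and reflects
the weights of the free Lie algebra. -/
lemma isLazardEmbedding_of_weight {L : Type*} [LieRing L] [LieAlgebra F L]
    (P : LazardSeries F L c) (φ : L →ₗ⁅F⁆ Amalgam PA PB f₀ g₀) (ι : L → FreeLieAlgebra F (A ⊕ B))
    (hφ : ∀ x, φ x = toAmalgam PA PB f₀ g₀ (ι x))
    (hι : ∀ n x, x ∈ P.P n ↔ Weight PA PB f₀ g₀ n (ι x)) :
    IsLazardEmbedding P (amalgamSeries PA PB f₀ g₀) φ := by
  have hinj : ∀ x, φ x = 0 → x = 0 := fun x hx => by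
    rw [hφ, ← map_zero (toAmalgam PA PB f₀ g₀), toAmalgam_eq_iff, sub_zero, ← hι,
      P.eq_bot_of_lt _ c.lt_succ_self] at hx
    simpa using hx
  refine ⟨(injective_iff_map_eq_zero φ).2 hinj, fun n x => ⟨fun h => ?_, fun h => ?_⟩⟩
  · exact ⟨ι x, (hι n x).1 h, (hφ x).symm⟩
  -- Beyond `c + 1` weights in the free Lie algebra say nothing about the quotient, but there the
  -- series is zero and injectivity decides.
  · by_cases hn : n ≤ c + 1
    · exact (hι n x).2 (Weight.of_toAmalgam_mem hn (hφ x ▸ h))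
    · rw [(amalgamSeries PA PB f₀ g₀).eq_bot_of_lt n (by omega), LieSubalgebra.mem_bot] at h
      rw [hinj x h]
      exact zero_mem _

lemma lieSpan_amalgam : LieSubalgebra.lieSpan F (Amalgam PA PB f₀ g₀)
    (Set.range (amalgamInl PA PB f₀ g₀) ∪ Set.range (amalgamInr PA PB f₀ g₀)) = ⊤ := by
  set K := LieSubalgebra.lieSpan F (Amalgam PA PB f₀ g₀)
    (Set.range (amalgamInl PA PB f₀ g₀) ∪ Set.range (amalgamInr PA PB f₀ g₀))
  have hK : K.comap (toAmalgam PA PB f₀ g₀) = ⊤ :=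
    FreeLieAlgebra.eq_top_of_forall_of_mem _ <| by
      rintro (a | b)
      · exact LieSubalgebra.subset_lieSpan (Or.inl ⟨a, rfl⟩)
      · exact LieSubalgebra.subset_lieSpan (Or.inr ⟨b, rfl⟩)
  refine eq_top_iff.2 fun s _ => ?_
  obtain ⟨x, rfl⟩ := toAmalgam_surjective PA PB f₀ g₀ s
  exact (hK ▸ LieSubalgebra.mem_top x : x ∈ K.comap (toAmalgam PA PB f₀ g₀))

lemma existsUnique_amalgam_lift {D : Type*} [LieRing D] [LieAlgebra F D] (PD : LazardSeries F D c)
    (f : A →ₗ⁅F⁆ D) (g : B →ₗ⁅F⁆ D) (hf : IsLazardHom PA PD f) (hg : IsLazardHom PB PD g)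
    (hfg : f.comp f₀ = g.comp g₀) :
    ∃! h : Amalgam PA PB f₀ g₀ →ₗ⁅F⁆ D, IsLazardHom (amalgamSeries PA PB f₀ g₀) PD h ∧
      h.comp (amalgamInl PA PB f₀ g₀) = f ∧ h.comp (amalgamInr PA PB f₀ g₀) = g := by
  have hw : ∀ {n x}, Weight PA PB f₀ g₀ n x → lift F (Sum.elim f g) x ∈ PD.P n := fun hx =>
    hx.lift_mem (Q := fun n => (PD.P n).toSubmodule) (fun _ _ h => PD.antitone h) PD.lie_mem
      hf hg (fun x => LieHom.congr_fun hfg x)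
  obtain ⟨h, hh⟩ := (relations PA PB f₀ g₀).exists_quotient_lift (lift F (Sum.elim f g))
    fun x hx => by
      have := hw hx
      rw [PD.eq_bot_of_lt _ c.lt_succ_self] at this
      simpa using this
  refine ⟨h, ⟨?_, ?_, ?_⟩, ?_⟩
  · rintro n _ ⟨x, hx, rfl⟩
    exact (hh x).symm ▸ hw hx
  · ext a
    exact (hh _).trans (by simp)
  · ext b
    exact (hh _).trans (by simp)
  · rintro h' ⟨-, hf', hg'⟩
    have hcomp : h'.comp (toAmalgam PA PB f₀ g₀) = lift F (Sum.elim f g) := by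
      refine FreeLieAlgebra.hom_ext ?_
      rintro (a | b)
      · simpa [amalgamInl_apply] using LieHom.congr_fun hf' a
      · simpa [amalgamInr_apply] using LieHom.congr_fun hg' b
    ext s
    obtain ⟨x, rfl⟩ := toAmalgam_surjective PA PB f₀ g₀ s
    exact (LieHom.congr_fun hcomp x).trans (hh x).symm

end

end LazardSeries

/-! ### Embeddings and strongness through the representation -/

open LazardSeries in
lemma isFreeAmalgam_amalgam {F : Type u} [Field F] {c : ℕ}
    {C : Type v₀} [LieRing C] [LieAlgebra F C] {A : Type v₁} [LieRing A] [LieAlgebra F A]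
    {B : Type v₂} [LieRing B] [LieAlgebra F B] {PC : LazardSeries F C c}
    (PA : LazardSeries F A c) (PB : LazardSeries F B c) {f₀ : C →ₗ⁅F⁆ A} {g₀ : C →ₗ⁅F⁆ B}
    (hf₀ : IsLazardEmbedding PC PA f₀) (hg₀ : IsLazardEmbedding PC PB g₀) :
    IsFreeAmalgam.{w} PA PB (amalgamSeries PA PB f₀ g₀) f₀ g₀
      (amalgamInl PA PB f₀ g₀) (amalgamInr PA PB f₀ g₀) := by
  obtain ⟨I, ω, f, g, hfg, hf, hg, hstrong⟩ := exists_strong_representation PC PA PB hf₀ hg₀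
  -- The filtration `endGE` need not vanish beyond `c`, so weights are tested on the free Lie
  -- algebra, before passing to the quotient.
  have hw : ∀ {n x}, Weight PA PB f₀ g₀ n x →
      FreeLieAlgebra.lift F (Sum.elim f g) x ∈ PBW.endGE F ω n := fun hx =>
    hx.lift_mem (PBW.endGE_antitone ω) (fun _ _ _ _ => PBW.lie_mem_endGE ω)
      (fun n a => (hf n a).1) (fun n b => (hg n b).1) hfg
  have hcomp : (amalgamInl PA PB f₀ g₀).comp f₀ = (amalgamInr PA PB f₀ g₀).comp g₀ := by
    ext x
    exact toAmalgam_eq_iff.2 (Weight.amalgam _ x)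
  refine ⟨?_, ?_, hcomp, lieSpan_amalgam PA PB f₀ g₀, ?_, fun D _ _ PD f g hf hg hfg =>
    existsUnique_amalgam_lift PA PB f₀ g₀ PD f g hf hg hfg⟩
  · exact isLazardEmbedding_of_weight PA PB f₀ g₀ PA _ _ (amalgamInl_apply PA PB f₀ g₀)
      fun n a => ⟨Weight.inl, fun h => (hf n a).2 (by simpa using hw h)⟩
  · exact isLazardEmbedding_of_weight PA PB f₀ g₀ PB _ _ (amalgamInr_apply PA PB f₀ g₀)
      fun n b => ⟨Weight.inr, fun h => (hg n b).2 (by simpa using hw h)⟩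
  · refine Set.Subset.antisymm ?_ ?_
    · rintro _ ⟨⟨a, rfl⟩, b, hb⟩
      -- Equality in the amalgam means that the difference of the two generators has weight `c + 1`.
      obtain ⟨x, rfl⟩ := hstrong a b (by simpa using hw (toAmalgam_eq_iff.1 hb.symm))
      exact ⟨x, rfl⟩
    · rintro _ ⟨x, rfl⟩
      exact ⟨⟨f₀ x, rfl⟩, g₀ x, (LieHom.congr_fun hcomp x).symm⟩

theorem theorem4p35 (F : Type u) [Field F] (c : ℕ)
    (C : Type v₀) [LieRing C] [LieAlgebra F C] (PC : LazardSeries F C c)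
    (A : Type v₁) [LieRing A] [LieAlgebra F A] (PA : LazardSeries F A c)
    (B : Type v₂) [LieRing B] [LieAlgebra F B] (PB : LazardSeries F B c)
    (f₀ : C →ₗ⁅F⁆ A) (hf₀ : IsLazardEmbedding PC PA f₀)
    (g₀ : C →ₗ⁅F⁆ B) (hg₀ : IsLazardEmbedding PC PB g₀) :
    ∃ (S : Type (max u v₁ v₂)) (_ : LieRing S) (_ : LieAlgebra F S) (PS : LazardSeries F S c)
      (f₁ : A →ₗ⁅F⁆ S) (g₁ : B →ₗ⁅F⁆ S),
      IsFreeAmalgam.{w} PA PB PS f₀ g₀ f₁ g₁ :=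
  ⟨_, inferInstance, inferInstance, LazardSeries.amalgamSeries PA PB f₀ g₀,
    LazardSeries.amalgamInl PA PB f₀ g₀, LazardSeries.amalgamInr PA PB f₀ g₀,
    isFreeAmalgam_amalgam PA PB hf₀ hg₀⟩
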